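/- Let $q$ be a prime power and let $\mathbb{F}_q$ be the field with $q$ elements. A \emph{monomial} is an expression $g=\prod_{i\ge 1}x_i^{\alpha(i)}$ with exponents $\alpha(i)\in\{0,1,2,\dots\}$ of which only finitely many, but at least one, are nonzero; its \emph{arity} is the largest $i$ with $\alpha(i)\neq 0$. For $n$ at least the arity of $g$, the $n$-ary function induced by $g$ is $\mathbb{F}_q^n\to\mathbb{F}_q$, $(x_1,\dots,x_n)\mapsto\prod_{i=1}^n x_i^{\alpha(i)}$. Two monomials are \emph{equivalent} if they have the same arity $n$ and induce the same $n$-ary function on $\mathbb{F}_q$. A \emph{clone} on $\mathbb{F}_q$ is a set of operations on $\mathbb{F}_q$ of positive finite arities that contains all projections and is closed under composition. A set $M$ of monomials is a \emph{monomial clone} on $\mathbb{F}_q$ if it contains every monomial that is equivalent to one of its members, and if the functions induced by the members of $M$ (in all admissible arities $n$) form a clone on $\mathbb{F}_q$. Monomial clones are ordered by inclusion; every set of monomials is contained in a least monomial clone, the one that it \emph{generates}. An \emph{infinite ascending chain} is a sequence $C_0\subsetneq C_1\subsetneq C_2\subsetneq\cdots$. Theorem. (1) Infinite ascending chains of monomial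 clones on $\mathbb{F}_q$ exist if and only if $q-1$ is not square-free. (2) If $k>1$ is an integer with $k^2\mid q-1$, then $q\ge 5$, and the monomial clones generated by the single monomials $f_i=\prod_{j=1}^{ki+1}x_j^{(q-1)/k}$, $i=0,1,2,\dots$, form an infinite ascending chain: for each $i$, the clone generated by $f_i$ is properly contained in the clone generated by $f_{i+1}$. (3) If $q-1$ is square-free, then there are only finitely many monomial clones on $\mathbb{F}_q$. -/

import Mathlib

namespace MonClone

/-- A clone on `A`, given by its sets `C n` of `n`-ary operations (all arities being positive):
it contains the projections and is closed under composition. -/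
structure IsClone {A : Type*} (C : ∀ n : ℕ, Set ((Fin n → A) → A)) : Prop where
  arity_pos : C 0 = ∅
  proj_mem : ∀ (n : ℕ) (j : Fin n), (fun x : Fin n → A => x j) ∈ C n
  comp_mem : ∀ (n m : ℕ) (f : (Fin n → A) → A) (g : Fin n → (Fin m → A) → A),
    f ∈ C n → (∀ i, g i ∈ C m) → (fun x : Fin m → A => f (fun i => g i x)) ∈ C m

/-- Monomials in the variables `x₁, x₂, …`: finitely supported sequences of exponents, not all of
them `0`. The exponent of the variable `x_{i+1}` is the value at the index `i`. -/
abbrev Monomial : Type := {α : ℕ →₀ ℕ // α ≠ 0}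

/-- The arity of a monomial: the largest `i` such that `x_i` has a nonzero exponent. -/
def Monomial.arity (g : Monomial) : ℕ := g.1.support.sup (fun i => i + 1)

/-- The `n`-ary function `(x₁, …, xₙ) ↦ x₁^α(1) ⋯ xₙ^α(n)` induced on `F` by a monomial
(used for `n` at least the arity of the monomial). -/
def Monomial.induced (F : Type*) [Field F] (g : Monomial) (n : ℕ) : (Fin n → F) → F :=
  fun x => ∏ i : Fin n, x i ^ g.1 (i : ℕ)

/-- Two monomials are equivalent if the functions that they induce on `F` in their respective
arities are equal (in particular the arities are equal). -/
def Monomial.Equivalent (F : Type*) [Field F] (g h : Monomial) : Prop :=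
  (⟨g.arity, g.induced F g.arity⟩ : Σ n : ℕ, (Fin n → F) → F) = ⟨h.arity, h.induced F h.arity⟩

/-- The operations induced on `F` by the monomials in `M`, sorted by arity. -/
def inducedOps (F : Type*) [Field F] (M : Set Monomial) (n : ℕ) : Set ((Fin n → F) → F) :=
  {f | ∃ g ∈ M, g.arity ≤ n ∧ f = g.induced F n}

/-- `M` is a monomial clone on `F`. -/
structure IsMonomialClone (F : Type*) [Field F] (M : Set Monomial) : Prop where
  isClone : IsClone (inducedOps F M)
  equivalent_mem : ∀ g ∈ M, ∀ h : Monomial, g.Equivalent F h → h ∈ M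

/-- The monomial clones on `F`, ordered by inclusion. -/
abbrev MonomialClone (F : Type*) [Field F] : Type := {M : Set Monomial // IsMonomialClone F M}

theorem Monomial.lt_arity (g : Monomial) {i : ℕ} (h : g.1 i ≠ 0) : i < g.arity :=
  Finset.le_sup (f := fun i => i + 1) (Finsupp.mem_support_iff.2 h)

theorem Monomial.arity_pos (g : Monomial) : 0 < g.arity := by
  obtain ⟨i, hi⟩ := Finsupp.ne_iff.1 g.2
  exact (Nat.zero_le i).trans_lt (g.lt_arity hi)

theorem Monomial.arity_le (g : Monomial) {n : ℕ} (h : ∀ i, g.1 i ≠ 0 → i < n) : g.arity ≤ n :=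
  Finset.sup_le fun i hi => h i (Finsupp.mem_support_iff.1 hi)

theorem Monomial.equivalent_of_induced_eq (F : Type*) [Field F] (g h : Monomial) (n : ℕ)
    (hg : g.arity ≤ n) (hh : h.arity ≤ n) (he : g.induced F n = h.induced F n) :
    g.Equivalent F h := by
  classical
  have key : ∀ (m : Monomial) (i : Fin n),
      m.induced F n (Function.update (fun _ => 1) i 0) = 0 ↔ m.1 i ≠ 0 := by
    intro m i
    simp only [Monomial.induced, Finset.prod_eq_zero_iff, Finset.mem_univ, true_and]
    constructor
    · rintro ⟨j, hj⟩
      by_cases hji : j = i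
      · subst hji
        intro h0
        simp [h0] at hj
      · simp [Function.update_of_ne hji] at hj
    · intro h0
      exact ⟨i, by simp [h0]⟩
  have hsupp : ∀ i, g.1 i ≠ 0 ↔ h.1 i ≠ 0 := by
    intro i
    by_cases hi : i < n
    · rw [← key g ⟨i, hi⟩, ← key h ⟨i, hi⟩, he]
    · constructor
      · intro h0
        exact absurd ((g.lt_arity h0).trans_le hg) hi
      · intro h0
        exact absurd ((h.lt_arity h0).trans_le hh) hi
  have har : g.arity = h.arity :=
    le_antisymm (g.arity_le fun i hi => h.lt_arity ((hsupp i).1 hi))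
      (h.arity_le fun i hi => g.lt_arity ((hsupp i).2 hi))
  have ext : ∀ (m : Monomial) (k : ℕ), m.arity ≤ k → k ≤ n → ∀ x : Fin k → F,
      m.induced F k x = m.induced F n (fun i => if hi : (i : ℕ) < k then x ⟨i, hi⟩ else 1) := by
    intro m k hm hk x
    obtain ⟨l, rfl⟩ := Nat.exists_eq_add_of_le hk
    simp only [Monomial.induced, Fin.prod_univ_add]
    simp
  have hfun : g.induced F g.arity = h.induced F g.arity := by
    funext x
    rw [ext g _ le_rfl hg, ext h _ har.ge hg, he]
  unfold Monomial.Equivalent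
  rw [hfun, har]

theorem isMonomialClone_univ (F : Type*) [Field F] : IsMonomialClone F Set.univ where
  equivalent_mem := fun _ _ _ _ => trivial
  isClone :=
    { arity_pos := by
        ext f
        simp only [inducedOps, Set.mem_univ, true_and, Set.mem_ofPred_eq, Set.mem_empty_iff_false,
          iff_false, not_exists, not_and]
        intro g hg
        exact absurd hg (by have := g.arity_pos; omega)
      proj_mem := by
        classical
        intro n j
        refine ⟨⟨Finsupp.single (j : ℕ) 1, by simp⟩, trivial, ?_, ?_⟩
        · refine Monomial.arity_le _ fun i hi => ?_
          have hij : (j : ℕ) = i := by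
            by_contra hne
            exact hi (Finsupp.single_eq_of_ne (Ne.symm hne))
          exact hij ▸ j.2
        · funext x
          simp only [Monomial.induced]
          rw [Finset.prod_eq_single j]
          · simp
          · intro b _ hb
            have hne : (j : ℕ) ≠ b := fun hc => hb (Fin.ext hc.symm)
            simp [hne]
          · simp
      comp_mem := by
        rintro n m f g ⟨a, -, ha, rfl⟩ hg
        choose b _ hb hgb using hg
        refine ⟨⟨∑ i : Fin n, a.1 i • (b i).1, ?_⟩, trivial, ?_, ?_⟩
        · obtain ⟨i, hi⟩ := Finsupp.ne_iff.1 a.2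
          have hin : i < n := (a.lt_arity hi).trans_le ha
          obtain ⟨j, hj⟩ := Finsupp.ne_iff.1 (b ⟨i, hin⟩).2
          refine Finsupp.ne_iff.2 ⟨j, ?_⟩
          rw [Finsupp.finsetSum_apply]
          intro h0
          have h1 := (Finset.sum_eq_zero_iff.1 h0) ⟨i, hin⟩ (Finset.mem_univ _)
          simp only [Finsupp.smul_apply, smul_eq_mul] at h1
          exact (mul_ne_zero hi hj) h1
        · refine Monomial.arity_le _ fun j hj => ?_
          rw [Finsupp.finsetSum_apply] at hj
          obtain ⟨i, -, hi⟩ := Finset.exists_ne_zero_of_sum_ne_zero hj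
          have hbj : (b i).1 j ≠ 0 := fun h0 => hi (by simp [h0])
          exact ((b i).lt_arity hbj).trans_le (hb i)
        · funext x
          simp only [hgb, Monomial.induced, Finsupp.finsetSum_apply, Finsupp.smul_apply,
            smul_eq_mul, ← Finset.prod_pow_eq_pow_sum]
          rw [Finset.prod_comm]
          refine Finset.prod_congr rfl fun i _ => ?_
          rw [← Finset.prod_pow]
          exact Finset.prod_congr rfl fun j _ => by rw [← pow_mul, mul_comm] }

theorem isMonomialClone_sInter (F : Type*) [Field F] (S : Set (Set Monomial))
    (hS : ∀ M ∈ S, IsMonomialClone F M) : IsMonomialClone F (⋂₀ S) := by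
  have hops : ∀ n f, f ∈ inducedOps F (⋂₀ S) n ↔
      f ∈ inducedOps F Set.univ n ∧ ∀ M ∈ S, f ∈ inducedOps F M n := by
    intro n f
    constructor
    · rintro ⟨g, hg, hgn, rfl⟩
      exact ⟨⟨g, trivial, hgn, rfl⟩, fun M hM => ⟨g, hg M hM, hgn, rfl⟩⟩
    · rintro ⟨⟨g, -, hgn, rfl⟩, h⟩
      refine ⟨g, fun M hM => ?_, hgn, rfl⟩
      obtain ⟨g', hg', hgn', he⟩ := h M hM
      exact (hS M hM).equivalent_mem g' hg' g
        (Monomial.equivalent_of_induced_eq F g' g n hgn' hgn he.symm)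
  have hu := (isMonomialClone_univ F).isClone
  refine ⟨⟨?_, fun n j => ?_, fun n m f g hf hg => ?_⟩, fun g hg h he M hM => ?_⟩
  · refine Set.eq_empty_of_forall_notMem fun f hf => ?_
    have h0 := ((hops 0 f).1 hf).1
    rw [hu.arity_pos] at h0
    exact h0
  · exact (hops n _).2 ⟨hu.proj_mem n j, fun M hM => (hS M hM).isClone.proj_mem n j⟩
  · rw [hops]
    exact ⟨hu.comp_mem n m f g ((hops n f).1 hf).1 fun i => ((hops m _).1 (hg i)).1,
      fun M hM => (hS M hM).isClone.comp_mem n m f g (((hops n f).1 hf).2 M hM)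
        fun i => ((hops m _).1 (hg i)).2 M hM⟩
  · exact (hS M hM).equivalent_mem g (hg M hM) h he

/-- The monomial clone on `F` generated by a set `M` of monomials: the least monomial clone on `F`
that contains `M`. -/
def generated (F : Type*) [Field F] (M : Set Monomial) : MonomialClone F :=
  ⟨⋂₀ {N | IsMonomialClone F N ∧ M ⊆ N}, isMonomialClone_sInter F _ fun _ hN => hN.1⟩

theorem isLeast_generated (F : Type*) [Field F] (M : Set Monomial) :
    IsLeast {N : MonomialClone F | M ⊆ N.1} (generated F M) :=
  ⟨Set.subset_sInter fun _ hN => hN.2, fun N hN => Set.sInter_subset_of_mem ⟨N.2, hN⟩⟩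

/-- The monomial `x₁^d x₂^d ⋯ xₙ^d`, for `n, d ≥ 1`. -/
noncomputable def powerMonomial (n d : ℕ) (hn : 0 < n) (hd : 0 < d) : Monomial :=
  ⟨∑ j ∈ Finset.range n, Finsupp.single j d, by
    refine Finsupp.ne_iff.2 ⟨0, ?_⟩
    simp [Finsupp.finsetSum_apply, Finsupp.single_apply, hn, hd.ne']⟩

/-- The exponent `(q - 1) / k` is positive when `q` is a prime power and `k² ∣ q - 1`. -/
theorem exponent_pos {q k : ℕ} (hq : IsPrimePow q) (h : k ^ 2 ∣ q - 1) : 0 < (q - 1) / k := by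
  have h1 : 0 < q - 1 := Nat.sub_pos_of_lt hq.one_lt
  have hk : k ∣ q - 1 := (dvd_pow_self k two_ne_zero).trans h
  exact Nat.div_pos (Nat.le_of_dvd h1 hk) (Nat.pos_of_dvd_of_pos hk h1)

end MonClone

/-! Put m = q - 1. On a field with q elements, x^a depends only on a mod m and on whether a = 0
(`ExpCong`). Hence a monomial clone amounts to a set of exponent sequences that contains the
variables and is closed under substitution up to this congruence (`isMonomialClone_iff`).

Let m be square-free. As ZMod m is reduced, each a satisfies a * a^(n+1) ≡ a mod m for some n. If a
monomial has enough exponents congruent to a, then m further ones can be removed by identifying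
variables, since their sum is 0 mod m (`mem_of_mem_extended`). They can also be added: substituting
x^e y^e z^c with e = a^(n+1) for m of the variables duplicates their exponents
(`mem_extended_of_mem`). By pigeonhole a clone is determined by its monomials in the first 2m²
variables with exponents at most m (`subset_of_small`), so there are finitely many clones.

Let k > 1, k² ∣ m and d = m / k. Then m ∣ d², so nesting monomials whose exponents are multiples of
d gives only exponents 0 mod m. Hence the number of exponents not divisible by m cannot grow
(`isExponentClone_boundedMonomials`), and f_i does not generate f_(i+1). Conversely f_(i+1)
generates f_i by identifying variables, since kd = m. -/

namespace MonClone

/-! ### Congruence of exponents -/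

/-- Two exponents are congruent if they define the same power function on a field
with `m + 1` elements. -/
def ExpCong (m a b : ℕ) : Prop := (a = 0 ↔ b = 0) ∧ a ≡ b [MOD m]

namespace ExpCong

variable {m : ℕ}

theorem refl (a : ℕ) : ExpCong m a a := ⟨Iff.rfl, Nat.ModEq.refl a⟩

theorem symm {a b : ℕ} (h : ExpCong m a b) : ExpCong m b a := ⟨h.1.symm, h.2.symm⟩

theorem trans {a b c : ℕ} (h : ExpCong m a b) (h' : ExpCong m b c) : ExpCong m a c :=
  ⟨h.1.trans h'.1, h.2.trans h'.2⟩

theorem add {a b c d : ℕ} (h : ExpCong m a b) (h' : ExpCong m c d) :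
    ExpCong m (a + c) (b + d) :=
  ⟨by rw [Nat.add_eq_zero_iff, Nat.add_eq_zero_iff, h.1, h'.1], h.2.add h'.2⟩

theorem mul {a b c d : ℕ} (h : ExpCong m a b) (h' : ExpCong m c d) :
    ExpCong m (a * c) (b * d) :=
  ⟨by rw [Nat.mul_eq_zero, Nat.mul_eq_zero, h.1, h'.1], h.2.mul h'.2⟩

theorem sum {ι : Type*} (s : Finset ι) {f g : ι → ℕ} (h : ∀ i ∈ s, ExpCong m (f i) (g i)) :
    ExpCong m (∑ i ∈ s, f i) (∑ i ∈ s, g i) := by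
  classical
  induction s using Finset.induction_on with
  | empty => exact refl _
  | insert a s ha ih =>
    rw [Finset.sum_insert ha, Finset.sum_insert ha]
    exact (h a (Finset.mem_insert_self a s)).add
      (ih fun i hi => h i (Finset.mem_insert_of_mem hi))

/-- The condition `b ≠ 0` matters: adding a positive multiple of `m` to the exponent 0 would make a
new variable occur. -/
theorem add_of_dvd {a b c : ℕ} (h : ExpCong m a b) (hb : b ≠ 0) (hc : m ∣ c) :
    ExpCong m (a + c) b := by
  refine ⟨iff_of_false (fun h0 => hb (h.1.1 (by omega))) hb, ?_⟩
  exact h.2.add (Nat.modEq_zero_iff_dvd.2 hc)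

theorem dvd_iff {a b d : ℕ} (h : ExpCong m a b) (hd : d ∣ m) : d ∣ a ↔ d ∣ b :=
  (h.2.of_dvd hd).dvd_iff dvd_rfl

/-- Every exponent is congruent to one that is at most `m`. -/
theorem exists_le (hm : 0 < m) (a : ℕ) : ∃ b, b ≤ m ∧ ExpCong m a b := by
  rcases Nat.eq_zero_or_pos a with rfl | ha
  · exact ⟨0, Nat.zero_le _, refl 0⟩
  -- The representatives are 1, …, m, so that positive multiples of `m` go to `m` and not to 0.
  · refine ⟨(a - 1) % m + 1, Nat.mod_lt _ hm, iff_of_false ha.ne' (Nat.succ_ne_zero _), ?_⟩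
    have h := (Nat.mod_modEq (a - 1) m).symm.add_right 1
    rwa [Nat.sub_add_cancel ha] at h

end ExpCong

/-! ### From functions on the field to exponents -/

/-- The point 0 detects whether the exponent is 0; a generator of the cyclic group of units detects
its residue. -/
theorem pow_eq_pow_iff_expCong (F : Type*) [Field F] [Finite F] (a b : ℕ) :
    (∀ x : F, x ^ a = x ^ b) ↔ ExpCong (Nat.card F - 1) a b := by
  constructor
  · intro h
    constructor
    · have h0 := h 0
      constructor
      · rintro rfl
        by_contra hb
        simp [hb] at h0
      · rintro rfl
        by_contra ha
        simp [ha] at h0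
    · obtain ⟨g, hg⟩ := IsCyclic.exists_generator (α := Fˣ)
      have h1 : g ^ a = g ^ b := Units.ext (by simpa using h g)
      rw [pow_eq_pow_iff_modEq, orderOf_eq_card_of_forall_mem_zpowers hg, Nat.card_units] at h1
      exact h1
  · rintro ⟨h0, hmod⟩ x
    rcases eq_or_ne x 0 with rfl | hx
    · by_cases ha : a = 0
      · rw [ha, h0.1 ha]
      · rw [zero_pow ha, zero_pow fun hb => ha (h0.2 hb)]
    · have h1 : (Units.mk0 x hx) ^ a = (Units.mk0 x hx) ^ b := by
        rw [pow_eq_pow_iff_modEq]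
        refine hmod.of_dvd ?_
        rw [← Nat.card_units]
        exact orderOf_dvd_natCard _
      simpa using congrArg Units.val h1

theorem Monomial.induced_restrict (F : Type*) [Field F] (g : Monomial) {n : ℕ} (hn : g.arity ≤ n)
    (x : ℕ → F) : g.induced F n (fun i => x i) = g.1.prod fun i a => x i ^ a := by
  rw [Finsupp.prod_of_support_subset g.1 (s := Finset.range n)]
  · exact Fin.prod_univ_eq_prod_range (fun i => x i ^ g.1 i) n
  · intro i hi
    exact Finset.mem_range.2 ((g.lt_arity (Finsupp.mem_support_iff.1 hi)).trans_le hn)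
  · simp

theorem Monomial.prod_update (F : Type*) [Field F] (α : ℕ →₀ ℕ) (i : ℕ) (t : F) :
    (α.prod fun l a => (Function.update (fun _ => 1) i t : ℕ → F) l ^ a) = t ^ α i := by
  rw [Finsupp.prod, Finset.prod_eq_single i]
  · simp
  · intro b _ hb
    simp [Function.update_of_ne hb]
  · intro hi
    simp [Finsupp.notMem_support_iff.1 hi]

theorem Monomial.equivalent_iff (F : Type*) [Field F] [Finite F] (g h : Monomial) :
    g.Equivalent F h ↔ ∀ i, ExpCong (Nat.card F - 1) (g.1 i) (h.1 i) := by
  constructor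
  · intro he i
    rw [← pow_eq_pow_iff_expCong F]
    intro t
    -- Evaluating at a point given by a sequence on all of ℕ makes sense in every arity at once, so
    -- the equality of dependent pairs needs no transport.
    have h1 := congrArg (fun s : Σ n : ℕ, (Fin n → F) → F =>
      s.2 fun l => (Function.update (fun _ => 1) i t : ℕ → F) l) he
    simpa only [Monomial.induced_restrict F _ le_rfl, Monomial.prod_update] using h1
  · intro hc
    refine equivalent_of_induced_eq F g h (max g.arity h.arity) (le_max_left _ _)
      (le_max_right _ _) ?_
    funext x
    exact Finset.prod_congr rfl fun i _ => (pow_eq_pow_iff_expCong F _ _).2 (hc i) (x i)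

/-- The monomial `x_{j+1}`. -/
noncomputable def Monomial.X (j : ℕ) : Monomial := ⟨Finsupp.single j 1, by simp⟩

/-- Composition of monomials in terms of exponents. -/
theorem Monomial.induced_comp (F : Type*) [Field F] [Finite F] {g h : Monomial} {b : ℕ → Monomial}
    {n k : ℕ} (hg : g.arity ≤ n)
    (hc : ∀ j, ExpCong (Nat.card F - 1) (h.1 j) (∑ i ∈ g.1.support, g.1 i * (b i).1 j)) :
    (fun x : Fin k → F => g.induced F n fun i => (b i).induced F k x) = h.induced F k := by
  funext x
  have h1 : ∀ j : Fin k, x j ^ h.1 j = ∏ i : Fin n, (x j ^ (b i).1 j) ^ g.1 i := by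
    intro j
    rw [(pow_eq_pow_iff_expCong F _ _).2 (hc j) (x j), ← Finset.prod_pow_eq_pow_sum]
    rw [Fin.prod_univ_eq_prod_range (fun i => (x j ^ (b i).1 j) ^ g.1 i) n]
    have hs : g.1.support ⊆ Finset.range n := fun i hi =>
      Finset.mem_range.2 ((g.lt_arity (Finsupp.mem_support_iff.1 hi)).trans_le hg)
    rw [← Finset.prod_subset hs fun i _ hi => by simp [Finsupp.notMem_support_iff.1 hi]]
    exact Finset.prod_congr rfl fun i _ => by rw [← pow_mul, mul_comm]
  simp only [Monomial.induced, h1]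
  rw [Finset.prod_comm]
  exact Finset.prod_congr rfl fun i _ => (Finset.prod_pow _ _ _).symm

theorem Monomial.arity_le_of_expCong {m : ℕ} {g h : Monomial} {b : ℕ → Monomial} {k : ℕ}
    (hb : ∀ i ∈ g.1.support, (b i).arity ≤ k)
    (hc : ∀ j, ExpCong m (h.1 j) (∑ i ∈ g.1.support, g.1 i * (b i).1 j)) : h.arity ≤ k := by
  refine h.arity_le fun j hj => ?_
  obtain ⟨i, hi, hij⟩ := Finset.exists_ne_zero_of_sum_ne_zero fun h0 => hj ((hc j).1.2 h0)
  exact ((b i).lt_arity (right_ne_zero_of_mul hij)).trans_le (hb i hi)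

/-- Sets of monomials that contain the variables and are closed under composition, where the
exponents are taken up to `ExpCong m`. -/
structure IsExponentClone (m : ℕ) (M : Set Monomial) : Prop where
  X_mem : ∀ j, Monomial.X j ∈ M
  comp_mem : ∀ g ∈ M, ∀ b : ℕ → Monomial, (∀ i, b i ∈ M) → ∀ h : Monomial,
    (∀ j, ExpCong m (h.1 j) (∑ i ∈ g.1.support, g.1 i * (b i).1 j)) → h ∈ M

theorem isMonomialClone_iff (F : Type*) [Field F] [Finite F] (M : Set Monomial) :
    IsMonomialClone F M ↔ IsExponentClone (Nat.card F - 1) M := by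
  have hX : ∀ (n : ℕ) (j : Fin n), (Monomial.X j).arity ≤ n ∧
      (fun x : Fin n → F => x j) = (Monomial.X j).induced F n := by
    intro n j
    constructor
    · refine Monomial.arity_le _ fun i hi => ?_
      have hij : (j : ℕ) = i := by
        by_contra hne
        exact hi (Finsupp.single_eq_of_ne (Ne.symm hne))
      exact hij ▸ j.2
    · funext x
      rw [Monomial.induced, Finset.prod_eq_single j]
      · simp [Monomial.X]
      · intro b _ hb
        have hne : (j : ℕ) ≠ b := fun hc => hb (Fin.ext hc.symm)
        simp [Monomial.X, hne]
      · simp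
  constructor
  · intro hM
    refine ⟨fun j => ?_, fun g hg b hb h hc => ?_⟩
    · obtain ⟨g, hg, hgn, he⟩ := hM.isClone.proj_mem (j + 1) (Fin.last j)
      obtain ⟨ha, hX'⟩ := hX (j + 1) (Fin.last j)
      exact hM.equivalent_mem g hg _
        (Monomial.equivalent_of_induced_eq F _ _ (j + 1) hgn ha (he.symm.trans hX'))
    · set n := g.arity with hn
      set k := (Finset.range n).sup fun i => (b i).arity with hk
      have hbk : ∀ i < n, (b i).arity ≤ k := fun i hi =>
        Finset.le_sup (f := fun i => (b i).arity) (Finset.mem_range.2 hi)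
      have hhk : h.arity ≤ k := Monomial.arity_le_of_expCong
        (fun i hi => hbk i (g.lt_arity (Finsupp.mem_support_iff.1 hi))) hc
      obtain ⟨g', hg', hgn', he⟩ := hM.isClone.comp_mem n k (g.induced F n)
        (fun i => (b i).induced F k) ⟨g, hg, le_rfl, rfl⟩ fun i => ⟨b i, hb i, hbk i i.2, rfl⟩
      rw [Monomial.induced_comp F le_rfl hc] at he
      exact hM.equivalent_mem g' hg' h
        (Monomial.equivalent_of_induced_eq F g' h k hgn' hhk he.symm)
  · rintro ⟨hvar, hcomp⟩
    refine ⟨⟨?_, fun n j => ⟨Monomial.X j, hvar j, hX n j⟩, ?_⟩, fun g hg h he => ?_⟩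
    · refine Set.eq_empty_of_forall_notMem ?_
      rintro f ⟨g, -, hg, -⟩
      exact absurd hg (by have := g.arity_pos; omega)
    · rintro n k f G ⟨g, hg, hgn, rfl⟩ hG
      choose b hbM hbk hbG using hG
      -- The padding by a variable is never used, since `g` has arity at most `n`.
      set B : ℕ → Monomial := fun i => if hi : i < n then b ⟨i, hi⟩ else Monomial.X 0 with hB
      have hBb : ∀ i : Fin n, B i = b i := fun i => by simp [hB]
      have hBM : ∀ i, B i ∈ M := fun i => by
        by_cases hi : i < n
        · simpa [hB, hi] using hbM ⟨i, hi⟩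
        · simpa [hB, hi] using hvar 0
      have hBk : ∀ i < n, (B i).arity ≤ k := fun i hi => by
        simpa [hB, hi] using hbk ⟨i, hi⟩
      have hval : ∀ j, (∑ i ∈ g.1.support, g.1 i • (B i).1) j =
          ∑ i ∈ g.1.support, g.1 i * (B i).1 j := fun j => by
        simp [Finsupp.finsetSum_apply]
      have hne : ∑ i ∈ g.1.support, g.1 i • (B i).1 ≠ 0 := by
        obtain ⟨i, hi⟩ := Finsupp.ne_iff.1 g.2
        obtain ⟨j, hj⟩ := Finsupp.ne_iff.1 (B i).2
        refine Finsupp.ne_iff.2 ⟨j, ?_⟩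
        rw [hval]
        intro h0
        exact mul_ne_zero hi hj (Finset.sum_eq_zero_iff.1 h0 i (Finsupp.mem_support_iff.2 hi))
      have hc : ∀ j, ExpCong (Nat.card F - 1)
          ((∑ i ∈ g.1.support, g.1 i • (B i).1) j) (∑ i ∈ g.1.support, g.1 i * (B i).1 j) :=
        fun j => by rw [hval]; exact ExpCong.refl _
      have hhk : Monomial.arity ⟨_, hne⟩ ≤ k := Monomial.arity_le_of_expCong (fun i hi =>
        hBk i ((g.lt_arity (Finsupp.mem_support_iff.1 hi)).trans_le hgn)) hc
      refine ⟨⟨_, hne⟩, hcomp g hg B hBM _ hc, hhk, ?_⟩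
      rw [← Monomial.induced_comp F (h := ⟨_, hne⟩) hgn hc]
      simp only [hbG, hBb]
    -- Closure under equivalence is substitution of the variables themselves, because composites are
    -- taken up to `ExpCong`.
    · refine hcomp g hg Monomial.X hvar h fun j => ?_
      rw [Finset.sum_eq_single j]
      · simpa [Monomial.X] using ((Monomial.equivalent_iff F g h).1 he j).symm
      · intro i _ hij
        simp [Monomial.X, hij]
      · intro hj
        simp [Finsupp.notMem_support_iff.1 hj]

/-! ### Substitutions in exponent sequences -/

theorem sum_support_mul_single (α : ℕ →₀ ℕ) (j : ℕ) :
    ∑ i ∈ α.support, α i * (Finsupp.single i 1 : ℕ →₀ ℕ) j = α j := by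
  rw [Finset.sum_eq_single j]
  · simp
  · intro i _ hij
    simp [hij]
  · intro hj
    simp [Finsupp.notMem_support_iff.1 hj]

/-- The exponent sequences of the monomials in a set. -/
def exponents (M : Set Monomial) : Set (ℕ →₀ ℕ) := Subtype.val '' M

theorem mem_exponents {M : Set Monomial} {g : Monomial} : g.1 ∈ exponents M ↔ g ∈ M :=
  Subtype.val_injective.mem_set_image

namespace IsExponentClone

variable {m : ℕ} {M : Set Monomial}

theorem single_mem (hM : IsExponentClone m M) (j : ℕ) : Finsupp.single j 1 ∈ exponents M :=
  ⟨Monomial.X j, hM.X_mem j, rfl⟩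

theorem comp (hM : IsExponentClone m M) {α β : ℕ →₀ ℕ} {b : ℕ → ℕ →₀ ℕ} (hα : α ∈ exponents M)
    (hb : ∀ i, b i ∈ exponents M)
    (hc : ∀ j, ExpCong m (β j) (∑ i ∈ α.support, α i * b i j)) : β ∈ exponents M := by
  obtain ⟨g, hg, rfl⟩ := hα
  choose B hB hBb using hb
  have hβ : β ≠ 0 := by
    rintro rfl
    obtain ⟨i, hi⟩ := Finsupp.ne_iff.1 g.2
    obtain ⟨j, hj⟩ := Finsupp.ne_iff.1 (B i).2
    have h0 := (hc j).1.1 rfl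
    rw [Finset.sum_eq_zero_iff] at h0
    have := h0 i (Finsupp.mem_support_iff.2 hi)
    rw [← hBb] at this
    exact mul_ne_zero hi hj this
  refine ⟨⟨β, hβ⟩, hM.comp_mem g hg B hB _ fun j => ?_, rfl⟩
  simpa only [hBb] using hc j

theorem mem_of_expCong (hM : IsExponentClone m M) {α β : ℕ →₀ ℕ} (hα : α ∈ exponents M)
    (hc : ∀ j, ExpCong m (β j) (α j)) : β ∈ exponents M :=
  hM.comp hα hM.single_mem fun j => by rw [sum_support_mul_single]; exact hc j

theorem mapDomain_mem (hM : IsExponentClone m M) {α : ℕ →₀ ℕ} (hα : α ∈ exponents M)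
    (f : ℕ → ℕ) : α.mapDomain f ∈ exponents M := by
  refine hM.comp hα (fun i => hM.single_mem (f i)) fun j => ?_
  rw [Finsupp.mapDomain, Finsupp.sum, Finsupp.finsetSum_apply]
  refine ExpCong.sum _ fun i _ => ?_
  simp only [Finsupp.single_apply, mul_ite, mul_one, mul_zero]
  exact ExpCong.refl _

/-- A monomial with exponents `e`, `e` and `b` in three variables, which may coincide. -/
def HasTernary (M : Set Monomial) (e b : ℕ) : Prop :=
  ∀ x y z : ℕ, Finsupp.single x e + Finsupp.single y e + Finsupp.single z b ∈ exponents M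

/-- Rename the two given variables to x and y, and all the others to z. -/
theorem hasTernary_of_mem (hM : IsExponentClone m M) {α : ℕ →₀ ℕ} (hα : α ∈ exponents M) {a : ℕ}
    {i₁ i₂ : ℕ} (hne : i₁ ≠ i₂) (h₁ : ExpCong m a (α i₁)) (h₂ : ExpCong m a (α i₂))
    (ha : a ≠ 0) : ∃ b, HasTernary M a b := by
  classical
  refine ⟨∑ i ∈ (α.support.erase i₁).erase i₂, α i, fun x y z => ?_⟩
  refine hM.comp hα (b := fun i => Finsupp.single (if i = i₁ then x else if i = i₂ then y else z) 1)
    (fun i => hM.single_mem _) fun j => ?_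
  have m₁ : i₁ ∈ α.support := Finsupp.mem_support_iff.2 fun h0 => ha (h₁.1.2 h0)
  have m₂ : i₂ ∈ α.support.erase i₁ :=
    Finset.mem_erase.2 ⟨hne.symm, Finsupp.mem_support_iff.2 fun h0 => ha (h₂.1.2 h0)⟩
  rw [← Finset.add_sum_erase _ _ m₁, ← Finset.add_sum_erase _ _ m₂, ← add_assoc]
  have hs : ∀ t c : ℕ, (Finsupp.single t c : ℕ →₀ ℕ) j = c * (Finsupp.single t 1 : ℕ →₀ ℕ) j := by
    intro t c
    simp [Finsupp.single_apply]
  rw [Finsupp.add_apply, Finsupp.add_apply, hs x, hs y, hs z, Finset.sum_mul, if_pos rfl,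
    if_neg hne.symm, if_pos rfl]
  refine ((h₁.mul (ExpCong.refl _)).add (h₂.mul (ExpCong.refl _))).add (ExpCong.sum _ fun i hi => ?_)
  have hi₂ := Finset.ne_of_mem_erase hi
  have hi₁ := Finset.ne_of_mem_erase (Finset.mem_of_mem_erase hi)
  rw [if_neg hi₁, if_neg hi₂]
  exact ExpCong.refl _

/-- In u^a v^a w^b, substitute x^e y^e z^c for u, and z for v and w. -/
theorem hasTernary_mul (hM : IsExponentClone m M) {a b e c : ℕ} (ha : HasTernary M a b)
    (he : HasTernary M e c) : ∃ d, HasTernary M (a * e) d := by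
  classical
  refine ⟨a * c + a + b, fun x y z => ?_⟩
  refine hM.comp (ha 0 1 2) (b := fun i => if i = 0 then
    Finsupp.single x e + Finsupp.single y e + Finsupp.single z c else Finsupp.single z 1)
    (fun i => ?_) fun j => ?_
  · split_ifs
    · exact he x y z
    · exact hM.single_mem z
  · have hsub : (Finsupp.single 0 a + Finsupp.single 1 a + Finsupp.single 2 b : ℕ →₀ ℕ).support ⊆
        Finset.range 3 := by
      intro i hi
      rw [Finset.mem_range]
      by_contra h3
      refine Finsupp.mem_support_iff.1 hi ?_
      rw [Finsupp.add_apply, Finsupp.add_apply, Finsupp.single_eq_of_ne (by omega),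
        Finsupp.single_eq_of_ne (by omega), Finsupp.single_eq_of_ne (by omega), add_zero, add_zero]
    rw [Finset.sum_subset hsub fun i _ hi => by rw [Finsupp.notMem_support_iff.1 hi, zero_mul]]
    have : ∀ t c : ℕ, (Finsupp.single t c : ℕ →₀ ℕ) j =
        c * (Finsupp.single t 1 : ℕ →₀ ℕ) j := by
      intro t c
      simp [Finsupp.single_apply]
    convert ExpCong.refl _ using 1
    rw [Finsupp.add_apply, Finsupp.add_apply, this x, this y, this z]
    simp [Finset.sum_range_succ]
    rw [this x e, this y e, this z c]
    ring

theorem hasTernary_pow (hM : IsExponentClone m M) {a b : ℕ} (ha : HasTernary M a b) (n : ℕ) :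
    ∃ c, HasTernary M (a ^ (n + 1)) c := by
  induction n with
  | zero => exact ⟨b, by simpa using ha⟩
  | succ n ih =>
    obtain ⟨c, hc⟩ := ih
    obtain ⟨d, hd⟩ := hM.hasTernary_mul ha hc
    exact ⟨d, by rwa [pow_succ']⟩

end IsExponentClone

/-! ### The square-free case: finitely many clones -/

theorem exists_mul_pow_modEq {m : ℕ} (hm : Squarefree m) (a : ℕ) :
    ∃ n, a * a ^ (n + 1) ≡ a [MOD m] := by
  have : NeZero m := ⟨hm.ne_zero⟩
  obtain ⟨i, j, hij, h⟩ : ∃ i j : ℕ, i < j ∧ (a : ZMod m) ^ i = (a : ZMod m) ^ j := by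
    obtain ⟨i, j, hne, h⟩ := Finite.exists_ne_map_eq_of_infinite fun n : ℕ => (a : ZMod m) ^ n
    rcases lt_or_gt_of_ne hne with hlt | hlt
    · exact ⟨i, j, hlt, h⟩
    · exact ⟨j, i, hlt, h.symm⟩
  obtain ⟨n, rfl⟩ := Nat.exists_eq_add_of_lt hij
  refine ⟨n, ?_⟩
  -- From a^i = a^(i+n+1) in `ZMod m` it follows that a * a^(n+1) - a is nilpotent; square-freeness
  -- then removes the exponent.
  have hdvd : (m : ℤ) ∣ ((a : ℤ) * a ^ (n + 1) - a) ^ (i + 1) := by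
    rw [← ZMod.intCast_zmod_eq_zero_iff_dvd]
    push_cast
    have h0 : (a : ZMod m) ^ i * ((a : ZMod m) ^ (n + 1) - 1) = 0 := by
      rw [mul_sub, ← pow_add, ← add_assoc, ← h, mul_one, sub_self]
    calc ((a : ZMod m) * a ^ (n + 1) - a) ^ (i + 1)
        = (a : ZMod m) ^ i * ((a : ZMod m) ^ (n + 1) - 1) *
          (a * ((a : ZMod m) ^ (n + 1) - 1) ^ i) := by
          rw [← mul_sub_one]
          generalize (a : ZMod m) ^ (n + 1) - 1 = t
          ring
      _ = 0 := by rw [h0, zero_mul]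
  have h1 := ((Int.squarefree_natCast.2 hm).dvd_pow_iff_dvd (Nat.succ_ne_zero i)).1 hdvd
  exact ((Nat.modEq_iff_dvd.2 (by exact_mod_cast h1)) : a ≡ a * a ^ (n + 1) [MOD m]).symm

theorem dvd_sum_of_modEq {m : ℕ} {s : Finset ℕ} (hs : s.card = m) {f : ℕ → ℕ} {a : ℕ}
    (hf : ∀ i ∈ s, f i ≡ a [MOD m]) : m ∣ ∑ i ∈ s, f i := by
  rw [← ZMod.natCast_eq_zero_iff, Nat.cast_sum,
    Finset.sum_congr rfl fun i hi => (ZMod.natCast_eq_natCast_iff _ _ _).2 (hf i hi)]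
  simp [hs]

namespace IsExponentClone

variable {m : ℕ} {M : Set Monomial}

/-- Congruent exponents can be dropped in bundles of `m`, by identifying variables. -/
theorem mem_of_mem_extended (hM : IsExponentClone m M) {α β : ℕ →₀ ℕ} {K : Finset ℕ}
    (hK : K.card = m) {a j₀ : ℕ} (hj₀ : β j₀ ≠ 0) (hβK : ∀ i ∈ K, β i = 0)
    (hαK : ∀ i ∈ K, α i ≡ a [MOD m]) (hαβ : ∀ i ∉ K, α i = β i) (hα : α ∈ exponents M) :
    β ∈ exponents M := by
  classical
  -- All variables in `K` become `j₀`. This adds a multiple of `m` to an exponent that is already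
  -- nonzero.
  refine hM.comp hα (b := fun i => Finsupp.single (if i ∈ K then j₀ else i) 1)
    (fun i => hM.single_mem _) fun j => ?_
  have hj₀K : j₀ ∉ K := fun h => hj₀ (hβK _ h)
  have hsub : α.support ⊆ β.support ∪ K := by
    intro i hi
    by_cases hiK : i ∈ K
    · exact Finset.mem_union_right _ hiK
    · refine Finset.mem_union_left _ (Finsupp.mem_support_iff.2 ?_)
      rw [← hαβ i hiK]
      exact Finsupp.mem_support_iff.1 hi
  have hdisj : Disjoint β.support K := by
    rw [Finset.disjoint_left]
    exact fun i hi hiK => Finsupp.mem_support_iff.1 hi (hβK i hiK)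
  rw [Finset.sum_subset hsub fun i _ hi => by rw [Finsupp.notMem_support_iff.1 hi, zero_mul],
    Finset.sum_union hdisj]
  have h₁ : ∑ i ∈ β.support, α i * (Finsupp.single (if i ∈ K then j₀ else i) 1 : ℕ →₀ ℕ) j
      = β j := by
    rw [← sum_support_mul_single β j]
    refine Finset.sum_congr rfl fun i hi => ?_
    have hiK := Finset.disjoint_left.1 hdisj hi
    rw [if_neg hiK, hαβ i hiK]
  have h₂ : ∑ i ∈ K, α i * (Finsupp.single (if i ∈ K then j₀ else i) 1 : ℕ →₀ ℕ) j
      = (∑ i ∈ K, α i) * (Finsupp.single j₀ 1 : ℕ →₀ ℕ) j := by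
    rw [Finset.sum_mul]
    exact Finset.sum_congr rfl fun i hi => by rw [if_pos hi]
  rw [h₁, h₂]
  by_cases hj : j = j₀
  · rw [hj]
    exact ((ExpCong.refl _).add_of_dvd hj₀ ((dvd_sum_of_modEq hK hαK).mul_right _)).symm
  · rw [Finsupp.single_eq_of_ne hj, mul_zero, add_zero]
    exact ExpCong.refl _

/-- Congruent exponents can be added in bundles of `m`, if there are enough of them. -/
theorem mem_extended_of_mem (hm : Squarefree m) (hM : IsExponentClone m M) {α β : ℕ →₀ ℕ}
    {J K : Finset ℕ} (hK : K.card = m) (hmJ : m < J.card) {a : ℕ} (ha : a ≠ 0)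
    (hJ0 : ∀ i ∈ J, β i ≠ 0) (hJ : ∀ i ∈ J, β i ≡ a [MOD m]) (hβK : ∀ i ∈ K, β i = 0)
    (hαK0 : ∀ i ∈ K, α i ≠ 0) (hαK : ∀ i ∈ K, α i ≡ a [MOD m]) (hαβ : ∀ i ∉ K, α i = β i)
    (hβ : β ∈ exponents M) : α ∈ exponents M := by
  classical
  have hcong : ∀ i ∈ J, ExpCong m a (β i) := fun i hi =>
    ⟨iff_of_false ha (hJ0 i hi), (hJ i hi).symm⟩
  -- The strict inequality `m < J.card` gives two variables even if `m = 1`.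
  obtain ⟨j₀, hj₀, j₁, hj₁, hne⟩ := Finset.one_lt_card.1
    ((Nat.one_le_iff_ne_zero.2 hm.ne_zero).trans_lt hmJ)
  obtain ⟨b, hb⟩ := hM.hasTernary_of_mem hβ hne (hcong _ hj₀) (hcong _ hj₁) ha
  obtain ⟨n, hn⟩ := exists_mul_pow_modEq hm a
  obtain ⟨c, hc⟩ := hM.hasTernary_pow hb n
  set e := a ^ (n + 1) with he
  have he0 : e ≠ 0 := pow_ne_zero _ ha
  have hae : ∀ i ∈ J, ExpCong m (β i * e) a := fun i hi =>
    ((hcong i hi).symm.mul (ExpCong.refl e)).trans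
      ⟨iff_of_false (mul_ne_zero ha he0) ha, hn⟩
  obtain ⟨K', hK'J, hK'⟩ := Finset.exists_subset_card_eq hmJ.le
  obtain ⟨ρ, hρ⟩ : ∃ ρ : ℕ → ℕ, Set.BijOn ρ (K' : Set ℕ) (K : Set ℕ) :=
    K'.finite_toSet.exists_bijOn_of_encard_eq
      (by rw [Set.encard_coe_eq_coe_finsetCard, Set.encard_coe_eq_coe_finsetCard, hK, hK'])
  have hj₀K : ∀ i ∈ J, i ∉ K := fun i hi hiK => hJ0 i hi (hβK i hiK)
  -- Each i in `K'` keeps its exponent mod `m` and passes a copy to the new variable `ρ i`. The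
  -- surplus factors z^c are collected in `j₀`, with total exponent divisible by `m`.
  refine hM.comp hβ (b := fun i => if i ∈ K' then
      Finsupp.single i e + Finsupp.single (ρ i) e + Finsupp.single j₀ c
    else Finsupp.single i 1) (fun i => ?_) fun j => ?_
  · split_ifs
    · exact hc _ _ _
    · exact hM.single_mem i
  have hsub : K' ⊆ β.support := fun i hi => Finsupp.mem_support_iff.2 (hJ0 i (hK'J hi))
  rw [← Finset.sum_sdiff hsub]
  have h₁ : ∑ i ∈ β.support \ K', β i * (if i ∈ K' then
      Finsupp.single i e + Finsupp.single (ρ i) e + Finsupp.single j₀ c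
      else Finsupp.single i 1 : ℕ →₀ ℕ) j = if j ∈ K' then 0 else β j := by
    rw [Finset.sum_congr rfl fun i hi => by rw [if_neg (Finset.mem_sdiff.1 hi).2]]
    rw [Finset.sum_eq_ite j]
    · split_ifs with h h' h' <;> simp_all
    · intro i _ hij
      rw [Finsupp.single_eq_of_ne hij.symm, mul_zero]
  have h₂ : ∑ i ∈ K', β i * (if i ∈ K' then
      Finsupp.single i e + Finsupp.single (ρ i) e + Finsupp.single j₀ c
      else Finsupp.single i 1 : ℕ →₀ ℕ) j = (if j ∈ K' then β j * e else 0) +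
        (∑ i ∈ K', if ρ i = j then β i * e else 0) +
        (∑ i ∈ K', β i) * (Finsupp.single j₀ c : ℕ →₀ ℕ) j := by
    rw [Finset.sum_mul, ← Finset.sum_ite_eq' K' j fun i => β i * e, ← Finset.sum_add_distrib,
      ← Finset.sum_add_distrib]
    refine Finset.sum_congr rfl fun i hi => ?_
    rw [if_pos hi, Finsupp.add_apply, Finsupp.add_apply, mul_add, mul_add]
    simp only [Finsupp.single_apply, mul_ite, mul_zero]
  rw [h₁, h₂]
  have hdvd : m ∣ (∑ i ∈ K', β i) * (Finsupp.single j₀ c : ℕ →₀ ℕ) j :=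
    (dvd_sum_of_modEq hK' fun i hi => hJ i (hK'J hi)).mul_right _
  by_cases hj : j ∈ K
  · have hjK' : j ∉ K' := fun h => hj₀K j (hK'J h) hj
    obtain ⟨i, hi, rfl⟩ := hρ.surjOn hj
    have hi' : i ∈ K' := hi
    have hsum : (∑ l ∈ K', if ρ l = ρ i then β l * e else 0) = β i * e := by
      rw [Finset.sum_eq_single i]
      · rw [if_pos rfl]
      · intro l hl hli
        exact if_neg fun h => hli (hρ.injOn hl hi h)
      · exact fun h => absurd hi' h
    have hαa : ExpCong m a (α (ρ i)) := ⟨iff_of_false ha (hαK0 _ hj), (hαK _ hj).symm⟩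
    rw [if_neg hjK', if_neg hjK', hβK _ hj, hsum, zero_add, zero_add]
    exact (((hae i (hK'J hi')).trans hαa).add_of_dvd (hαK0 _ hj) hdvd).symm
  · have hsum : (∑ l ∈ K', if ρ l = j then β l * e else 0) = 0 :=
      Finset.sum_eq_zero fun l hl => if_neg fun h => hj (by rw [← h]; exact hρ.mapsTo hl)
    rw [hsum, hαβ j hj, add_zero, ← add_assoc]
    have hmain : ExpCong m ((if j ∈ K' then 0 else β j) + if j ∈ K' then β j * e else 0)
        (β j) := by
      split_ifs with h
      · rw [zero_add]
        exact (hae j (hK'J h)).trans (hcong j (hK'J h))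
      · exact ExpCong.refl _
    by_cases hjj : j = j₀
    · exact (hmain.add_of_dvd (hjj ▸ hJ0 j₀ hj₀) hdvd).symm
    · rw [Finsupp.single_eq_of_ne hjj, mul_zero, add_zero]
      exact hmain.symm

/-- If `m` is square-free, then a clone is determined by its monomials of small arity. -/
theorem subset_of_small (hm : Squarefree m) {D : Set Monomial} (hM : IsExponentClone m M)
    (hD : IsExponentClone m D)
    (h : ∀ α ∈ (Finset.range (m * (2 * m))).finsupp fun _ => Finset.range (m + 1),
      α ∈ exponents M → α ∈ exponents D) (α : ℕ →₀ ℕ) (hα : α ∈ exponents M) :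
    α ∈ exponents D := by
  classical
  have hm0 : 0 < m := Nat.pos_of_ne_zero hm.ne_zero
  induction hn : α.support.card using Nat.strong_induction_on generalizing α with
  | _ n ih =>
  subst hn
  by_cases hcard : α.support.card ≤ m * (2 * m)
  -- Few variables: rename them injectively into the range, reduce the exponents, pass to `D`, and
  -- undo both changes there.
  · obtain ⟨τ, hτ, hτinj⟩ := α.support.finite_toSet.exists_injOn_of_encard_le
      (t := (Finset.range (m * (2 * m)) : Set ℕ)) (by
        rw [Set.encard_coe_eq_coe_finsetCard, Set.encard_coe_eq_coe_finsetCard, Finset.card_range]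
        exact_mod_cast hcard)
    have hleft : ∀ i ∈ α.support, Function.invFunOn τ α.support (τ i) = i := fun i hi =>
      hτinj.leftInvOn_invFunOn hi
    choose r hr hrc using ExpCong.exists_le hm0
    have hr0 : r 0 = 0 := (hrc 0).1.1 rfl
    have hmem : ((α.mapDomain τ).mapRange r hr0) ∈ exponents M :=
      hM.mem_of_expCong (hM.mapDomain_mem hα τ) fun j => (hrc _).symm
    have hmemD := h _ (Finset.mem_finsupp_iff.2 ⟨fun j hj => ?_, fun j _ => ?_⟩) hmem
    · have h1 : α.mapDomain τ ∈ exponents D := hD.mem_of_expCong hmemD fun j => hrc _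
      have h2 := hD.mapDomain_mem h1 (Function.invFunOn τ α.support)
      rw [← Finsupp.mapDomain_comp] at h2
      have h3 : α.mapDomain (Function.invFunOn τ α.support ∘ τ) = α.mapDomain id :=
        Finsupp.mapDomain_congr hleft
      rwa [h3, Finsupp.mapDomain_id] at h2
    · obtain ⟨i, hi, rfl⟩ := Finset.mem_image.1
        (Finsupp.mapDomain_support (Finsupp.support_mapRange hj))
      exact hτ hi
    · rw [Finsupp.mapRange_apply, Finset.mem_range]
      exact Nat.lt_succ_of_le (hr _)
  · rw [not_le] at hcard
    -- More than 2m exponents share a residue: m of them are dropped, and more than m remain for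
    -- restoring these inside `D`.
    obtain ⟨y, hy, hfiber⟩ := Finset.exists_lt_card_fiber_of_mul_lt_card_of_maps_to
      (s := α.support) (t := Finset.range m) (f := fun i => α i % m) (n := 2 * m)
      (fun i _ => Finset.mem_range.2 (Nat.mod_lt _ hm0)) (by simpa using hcard)
    set I := {i ∈ α.support | α i % m = y} with hI
    have hI0 : ∀ i ∈ I, α i ≠ 0 := fun i hi =>
      Finsupp.mem_support_iff.1 (Finset.mem_filter.1 hi).1
    -- The representative `y + m` is used since it is nonzero even for `y = 0`.
    have hIa : ∀ i ∈ I, α i ≡ y + m [MOD m] := fun i hi => by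
      rw [Nat.ModEq, (Finset.mem_filter.1 hi).2, Nat.add_mod_right,
        Nat.mod_eq_of_lt (Finset.mem_range.1 hy)]
    obtain ⟨K, hKI, hK⟩ := Finset.exists_subset_card_eq (show m ≤ I.card by omega)
    have hJ : m < (I \ K).card := by
      rw [Finset.card_sdiff_of_subset hKI]
      omega
    set β := α.filter fun i => i ∉ K with hβ
    have hβK : ∀ i ∈ K, β i = 0 := fun i hi => Finsupp.filter_apply_neg _ _ (not_not.2 hi)
    have hαβ : ∀ i ∉ K, α i = β i := fun i hi =>
      (Finsupp.filter_apply_pos (fun i => i ∉ K) α hi).symm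
    have hJβ : ∀ i ∈ I \ K, β i ≠ 0 := fun i hi => by
      rw [← hαβ i (Finset.mem_sdiff.1 hi).2]
      exact hI0 i (Finset.mem_sdiff.1 hi).1
    obtain ⟨j₀, hj₀⟩ := Finset.card_pos.1 (hm0.trans hJ)
    have hβM := hM.mem_of_mem_extended hK (hJβ j₀ hj₀) hβK (fun i hi => hIa i (hKI hi)) hαβ hα
    have hlt : β.support.card < α.support.card := by
      refine Finset.card_lt_card ((Finset.ssubset_iff_of_subset ?_).2 ?_)
      · intro i hi
        rw [Finsupp.mem_support_iff] at hi ⊢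
        by_cases hiK : i ∈ K
        · exact absurd (hβK i hiK) hi
        · rwa [hαβ i hiK]
      · obtain ⟨k, hk⟩ := Finset.card_pos.1 (hK ▸ hm0)
        exact ⟨k, Finsupp.mem_support_iff.2 (hI0 k (hKI hk)),
          Finsupp.notMem_support_iff.2 (hβK k hk)⟩
    refine mem_extended_of_mem hm hD hK hJ (Nat.add_pos_right y hm0).ne' hJβ (fun i hi => ?_) hβK
      (fun i hi => hI0 i (hKI hi)) (fun i hi => hIa i (hKI hi)) hαβ (ih _ hlt β hβM rfl)
    rw [← hαβ i (Finset.mem_sdiff.1 hi).2]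
    exact hIa i (Finset.mem_sdiff.1 hi).1

end IsExponentClone

theorem finite_monomialClone (F : Type*) [Field F] [Finite F]
    (hm : Squarefree (Nat.card F - 1)) : Finite (MonomialClone F) := by
  set m := Nat.card F - 1
  let T := (Finset.range (m * (2 * m))).finsupp fun _ => Finset.range (m + 1)
  let r : MonomialClone F → Set T := fun C => {α | α.1 ∈ exponents C.1}
  have key : ∀ C D : MonomialClone F, r C = r D → C.1 ⊆ D.1 := by
    intro C D h g hg
    refine mem_exponents.1 (((isMonomialClone_iff F C.1).1 C.2).subset_of_small hm
      ((isMonomialClone_iff F D.1).1 D.2) (fun α hα hC => ?_) g.1 (mem_exponents.2 hg))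
    have h1 : (⟨α, hα⟩ : T) ∈ r C := hC
    rw [h] at h1
    exact h1
  exact Finite.of_injective r fun C D h =>
    Subtype.ext (Set.Subset.antisymm (key C D h) (key D C h.symm))

/-! ### The ascending chain -/

/-- The monomials that are equivalent to a variable, or whose exponents are multiples of `d`, at
most `r` of them not multiples of `m`. -/
def boundedMonomials (m d r : ℕ) : Set Monomial :=
  {g | (∃ j, ∀ l, ExpCong m (g.1 l) ((Finsupp.single j 1 : ℕ →₀ ℕ) l)) ∨
    ((∀ l, d ∣ g.1 l) ∧ (g.1.support.filter fun l => ¬ m ∣ g.1 l).card ≤ r)}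

theorem isExponentClone_boundedMonomials {m d : ℕ} (hdm : d ∣ m) (hmd : m ∣ d * d) (r : ℕ) :
    IsExponentClone m (boundedMonomials m d r) := by
  classical
  refine ⟨fun j => Or.inl ⟨j, fun l => ExpCong.refl _⟩, fun g hg b hb h hc => ?_⟩
  rcases hg with ⟨j, hj⟩ | ⟨hgd, hgr⟩
  · have hs : g.1.support = {j} := by
      ext l
      rw [Finsupp.mem_support_iff, Finset.mem_singleton, Ne, (hj l).1]
      simp [Finsupp.single_apply, eq_comm]
    have hcj : ∀ l, ExpCong m (h.1 l) ((b j).1 l) := by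
      intro l
      have h1 := hc l
      rw [hs, Finset.sum_singleton] at h1
      have h2 := (hj j).mul (ExpCong.refl ((b j).1 l))
      rw [Finsupp.single_eq_same, one_mul] at h2
      exact h1.trans h2
    rcases hb j with ⟨i, hi⟩ | ⟨hbd, hbr⟩
    · exact Or.inl ⟨i, fun l => (hcj l).trans (hi l)⟩
    · refine Or.inr ⟨fun l => ((hcj l).dvd_iff hdm).2 (hbd l), ?_⟩
      convert hbr using 2
      ext l
      rw [Finset.mem_filter, Finset.mem_filter, Finsupp.mem_support_iff, Finsupp.mem_support_iff,
        Ne, (hcj l).1, (hcj l).dvd_iff dvd_rfl]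
  · refine Or.inr ⟨fun l => ((hc l).dvd_iff hdm).2
      (Finset.dvd_sum fun i _ => (hgd i).mul_right _), le_trans ?_ hgr⟩
    -- Each outer variable contributes a non-multiple of `m` in at most one position: a substituted
    -- variable has one position, and any other inner monomial gives multiples of d², where the
    -- choice 0 is arbitrary.
    have hv : ∀ i, ∃ j, ∀ l, ¬ m ∣ g.1 i * (b i).1 l → l = j := by
      intro i
      rcases hb i with ⟨j, hj⟩ | ⟨hbd, -⟩
      · refine ⟨j, fun l hl => ?_⟩
        by_contra hlj
        have h0 := (hj l).1.2 (Finsupp.single_eq_of_ne hlj)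
        exact hl (by rw [h0, mul_zero]; exact dvd_zero m)
      · exact ⟨0, fun l hl => absurd (hmd.trans (mul_dvd_mul (hgd i) (hbd l))) hl⟩
    choose J hJ using hv
    refine le_trans (Finset.card_le_card fun l hl => ?_) (Finset.card_image_le (f := J))
    rw [Finset.mem_filter, (hc l).dvd_iff dvd_rfl] at hl
    obtain ⟨i, hi, hil⟩ : ∃ i ∈ g.1.support, ¬ m ∣ g.1 i * (b i).1 l := by
      by_contra hall
      push Not at hall
      exact hl.2 (Finset.dvd_sum hall)
    exact Finset.mem_image.2 ⟨i, Finset.mem_filter.2 ⟨hi, fun hd => hil (hd.mul_right _)⟩,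
      (hJ i l hil).symm⟩

theorem powerMonomial_apply (n d : ℕ) (hn : 0 < n) (hd : 0 < d) (l : ℕ) :
    (powerMonomial n d hn hd).1 l = if l < n then d else 0 := by
  simp [powerMonomial, Finsupp.finsetSum_apply, Finsupp.single_apply]

theorem powerMonomial_support (n d : ℕ) (hn : 0 < n) (hd : 0 < d) :
    (powerMonomial n d hn hd).1.support = Finset.range n := by
  ext l
  rw [Finsupp.mem_support_iff, powerMonomial_apply, Finset.mem_range]
  split_ifs with h
  · exact iff_of_true hd.ne' h
  · exact iff_of_false (not_not.2 rfl) h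

theorem powerMonomial_mem_boundedMonomials {m n d r : ℕ} (hn : 0 < n) (hd : 0 < d) (h : n ≤ r) :
    powerMonomial n d hn hd ∈ boundedMonomials m d r := by
  refine Or.inr ⟨fun l => ?_, (Finset.card_filter_le _ _).trans ?_⟩
  · rw [powerMonomial_apply]
    split_ifs
    exacts [dvd_rfl, dvd_zero d]
  · rwa [powerMonomial_support, Finset.card_range]

theorem le_of_powerMonomial_mem_boundedMonomials {m n d r : ℕ} (hn : 1 < n) (hn0 : 0 < n)
    (hd : 0 < d) (hmd : ¬ m ∣ d) (h : powerMonomial n d hn0 hd ∈ boundedMonomials m d r) :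
    n ≤ r := by
  rcases h with ⟨j, hj⟩ | ⟨-, h⟩
  · have h1 : ∀ l < n, l = j := by
      intro l hl
      by_contra hlj
      have h2 := (hj l).1.2 (Finsupp.single_eq_of_ne hlj)
      rw [powerMonomial_apply, if_pos hl] at h2
      exact hd.ne' h2
    exact absurd ((h1 0 hn0).trans (h1 1 hn).symm) zero_ne_one
  · rwa [Finset.filter_true_of_mem, powerMonomial_support, Finset.card_range] at h
    intro l hl
    rw [powerMonomial_support, Finset.mem_range] at hl
    rwa [powerMonomial_apply, if_pos hl]

/-- Identifying `k + 1` variables in the product of `n + k` powers. -/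
theorem IsExponentClone.powerMonomial_mem {m n d k : ℕ} {M : Set Monomial}
    (hM : IsExponentClone m M) (hn : 0 < n) (hd : 0 < d) (hm : m ∣ k * d) (hnk : 0 < n + k)
    (h : powerMonomial (n + k) d hnk hd ∈ M) : powerMonomial n d hn hd ∈ M := by
  refine hM.comp_mem _ h (fun i => Monomial.X (if i < n then i else 0)) (fun i => hM.X_mem _) _
    fun j => ?_
  have hsum : ∑ i ∈ (powerMonomial (n + k) d hnk hd).1.support,
      (powerMonomial (n + k) d hnk hd).1 i * (Monomial.X (if i < n then i else 0)).1 j =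
      (if j < n then d else 0) + if j = 0 then k * d else 0 := by
    rw [powerMonomial_support, Finset.sum_range_add]
    congr 1
    · rw [Finset.sum_congr rfl fun i hi => by
        rw [powerMonomial_apply, if_pos ((Finset.mem_range.1 hi).trans_le (Nat.le_add_right n k)),
          if_pos (Finset.mem_range.1 hi)]]
      simp [Monomial.X, Finsupp.single_apply]
    · rw [Finset.sum_congr rfl fun i hi => by
        rw [powerMonomial_apply, if_pos (Nat.add_lt_add_left (Finset.mem_range.1 hi) n),
          if_neg (by omega)]]
      by_cases hj : j = 0
      · simp [Monomial.X, hj]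
      · simp [Monomial.X, hj]
  rw [hsum, powerMonomial_apply]
  by_cases hj : j = 0
  · rw [if_pos hj, if_pos (hj ▸ hn)]
    exact ((ExpCong.refl d).add_of_dvd hd.ne' hm).symm
  · rw [if_neg hj, add_zero]
    exact ExpCong.refl _

theorem generated_le_iff (F : Type*) [Field F] (g : Monomial) (N : MonomialClone F) :
    generated F {g} ≤ N ↔ g ∈ N.1 :=
  ⟨fun h => h ((isLeast_generated F {g}).1 rfl),
    fun h => (isLeast_generated F {g}).2 (Set.singleton_subset_iff.2 h)⟩

theorem strictMono_generated_powerMonomial (F : Type*) [Field F] [Finite F] {k d : ℕ}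
    (hk : 1 < k) (hd : 0 < d) (hkd : k ∣ d) (hq : Nat.card F - 1 = d * k) :
    StrictMono fun i : ℕ => generated F {powerMonomial (k * i + 1) d (Nat.succ_pos _) hd} := by
  refine strictMono_nat_of_lt_succ fun i => lt_of_le_not_ge ?_ fun hle => ?_
  · rw [generated_le_iff]
    refine ((isMonomialClone_iff F _).1 (generated F _).2).powerMonomial_mem
      (n := k * i + 1) (k := k) (Nat.succ_pos _) hd (by rw [hq, mul_comm]) (by omega) ?_
    have h := (generated_le_iff F (powerMonomial (k * (i + 1) + 1) d (Nat.succ_pos _) hd) _).1 le_rfl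
    convert h using 2
    ring
  -- The clone with bound ki + 1 contains f_i but not f_(i+1).
  · have hB := isExponentClone_boundedMonomials (m := Nat.card F - 1) (d := d)
      (by rw [hq]; exact dvd_mul_right d k) (by rw [hq]; exact mul_dvd_mul_left d hkd) (k * i + 1)
    have hmd : ¬ (Nat.card F - 1) ∣ d := by
      rw [hq]
      intro h
      have h1 := Nat.le_of_dvd hd h
      nlinarith
    have hle' : generated F {powerMonomial (k * i + 1) d (Nat.succ_pos _) hd} ≤
        ⟨boundedMonomials (Nat.card F - 1) d (k * i + 1), (isMonomialClone_iff F _).2 hB⟩ := by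
      rw [generated_le_iff]
      exact powerMonomial_mem_boundedMonomials _ hd le_rfl
    have hmem := (generated_le_iff F _ _).1 (hle.trans hle')
    have hn : k * i + 1 < k * (i + 1) + 1 := by
      rw [mul_add, mul_one]
      omega
    have h1 := le_of_powerMonomial_mem_boundedMonomials (by omega) _ hd hmd hmem
    omega

end MonClone

/-! ### The theorem -/

theorem mainTheorem2 (q : ℕ) (hq : IsPrimePow q) (F : Type*) [Field F] (hF : Nat.card F = q) :
    ((∃ C : ℕ → MonClone.MonomialClone F, StrictMono C) ↔ ¬ Squarefree (q - 1)) ∧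
    (∀ (k : ℕ) (_ : 1 < k) (hkq : k ^ 2 ∣ q - 1),
      5 ≤ q ∧
      StrictMono fun i : ℕ => MonClone.generated F
        {MonClone.powerMonomial (k * i + 1) ((q - 1) / k) (Nat.succ_pos _)
          (MonClone.exponent_pos hq hkq)}) ∧
    (Squarefree (q - 1) → Finite (MonClone.MonomialClone F)) := by
  have hfin : Finite F := Nat.finite_of_card_ne_zero (by rw [hF]; exact hq.ne_zero)
  have hq1 : 0 < q - 1 := Nat.sub_pos_of_lt hq.one_lt
  have chain : ∀ (k : ℕ) (_ : 1 < k) (hkq : k ^ 2 ∣ q - 1),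
      StrictMono fun i : ℕ => MonClone.generated F
        {MonClone.powerMonomial (k * i + 1) ((q - 1) / k) (Nat.succ_pos _)
          (MonClone.exponent_pos hq hkq)} := by
    intro k hk hkq
    have hkq' : k ∣ q - 1 := (dvd_pow_self k two_ne_zero).trans hkq
    refine MonClone.strictMono_generated_powerMonomial F hk _ ?_ ?_
    · exact (Nat.dvd_div_iff_mul_dvd hkq').2 (by rwa [← sq])
    · rw [hF, Nat.div_mul_cancel hkq']
  have finite : Squarefree (q - 1) → Finite (MonClone.MonomialClone F) := fun h =>
    MonClone.finite_monomialClone F (by rwa [hF])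
  refine ⟨⟨?_, fun h => ?_⟩, fun k hk hkq => ⟨?_, chain k hk hkq⟩, finite⟩
  · rintro ⟨C, hC⟩ h
    have := finite h
    exact not_injective_infinite_finite C hC.injective
  · rw [Nat.squarefree_iff_prime_squarefree] at h
    push Not at h
    obtain ⟨p, hp, hpq⟩ := h
    exact ⟨_, chain p hp.one_lt (by rwa [sq])⟩
  · have h4 : 2 ^ 2 ≤ k ^ 2 := Nat.pow_le_pow_left hk 2
    have := Nat.le_of_dvd hq1 hkq
    omega
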